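/- Let $d,\ell$ be natural numbers and let $F:\mathbb{R}^d\rightrightarrows\mathbb{R}^\ell$ be a set-valued map such that every value $F(x)$ is compact, strictly convex and has nonempty interior. For $p\in\mathbb{R}^\ell$ put $\sigma_{F(x)}(p)=\max_{y\in F(x)}\langle p,y\rangle$ and $Y(x,p)=\{y\in F(x):\langle p,y\rangle=\sigma_{F(x)}(p)\}$, and let $\mathrm{B}$ be the closed Euclidean unit ball of $\mathbb{R}^\ell$. Assume that $F$ is locally isotropically Lipschitz: for every $x_0\in\mathbb{R}^d$ there are $k>0$ and a neighbourhood $U$ of $x_0$ such that $$Y(x,p)\subset Y(x',p)+k\,|x-x'|\,\mathrm{B}\qquad\text{for all }p\in\mathbb{R}^\ell\text{ and all }x,x'\in U.$$ For $\bar y\in F(\bar x)$, let the graphical derivative $DF(\bar x,\bar y):\mathbb{R}^d\rightrightarrows\mathbb{R}^\ell$ be the set-valued map whose graph is the contingent (Bouligand) tangent cone at $(\bar x,\bar y)$ of $\mathrm{gph}(F)=\{(x,y):y\in F(x)\}$, that is, the set of all $(u,w)$ for which there exist $h_n>0$, $h_n\to0$ and $(u_n,w_n)\to(u,w)$ with $\bar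 y+h_nw_n\in F(\bar x+h_nu_n)$ for all $n$. The map $F$ is called differentiable at $(\bar x,\bar y)\in\mathrm{gph}(F)$ if $\mathrm{gph}(F)$ is closed and $DF(\bar x,\bar y)$ is a convex process, i.e. its graph is a closed convex cone. Then for almost every $\bar x\in\mathbb{R}^d$ (with respect to Lebesgue measure) and for almost every $\bar y\in\partial F(\bar x)$ (with respect to the $(\ell-1)$-dimensional Hausdorff measure on $\partial F(\bar x)$), the map $F$ is differentiable at $(\bar x,\bar y)$, and $\mathrm{gph}(DF(\bar x,\bar y))$ is a closed half-space. More precisely, for such $\bar x,\bar y$ there is exactly one unit vector $\bar p$ in the normal cone $\{q:\langle q,z-\bar y\rangle\le0\ \text{for all } z\in F(\bar x)\}$ of $F(\bar x)$ at $\bar y$, the function $x\mapsto\sigma_{F(x)}(\bar p)$ is (Fréchet) differentiable at $\bar x$ with derivative $\nabla_x\sigma_{F(\bar x)}(\bar p)$, and $$\mathrm{gph}(DF(\bar x,\bar y))=\{(u,w)\in\mathbb{R}^d\times\mathbb{R}^\ell:\ \nabla_x\sigma_{F(\bar x)}(\bar p)(u)\ge\langle\bar p,w\rangle\}.$$ 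-/

import Mathlib

open MeasureTheory Filter Topology
open scoped RealInnerProductSpace Pointwise

noncomputable section

namespace SetValuedMap

/-- The contingent (Bouligand) tangent cone of `K` at `a`. -/
def tangentCone {V : Type*} [NormedAddCommGroup V] [NormedSpace ℝ V] (K : Set V) (a : V) : Set V :=
  {u | ∃ (h : ℕ → ℝ) (v : ℕ → V), (∀ n, 0 < h n) ∧ Tendsto h atTop (𝓝 0) ∧
    Tendsto v atTop (𝓝 u) ∧ ∀ n, a + h n • v n ∈ K}

/-- A closed half-space (with the origin on its boundary): the set where a nonzero continuous
linear form is nonpositive. -/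
def IsClosedHalfSpace {V : Type*} [NormedAddCommGroup V] [NormedSpace ℝ V] (S : Set V) : Prop :=
  ∃ φ : V →L[ℝ] ℝ, φ ≠ 0 ∧ S = {v | φ v ≤ 0}

section

variable {X Y : Type*} [NormedAddCommGroup X] [InnerProductSpace ℝ X]
  [NormedAddCommGroup Y] [InnerProductSpace ℝ Y]

/-- The graph of a set-valued map. -/
def graph (F : X → Set Y) : Set (X × Y) := {z | z.2 ∈ F z.1}

/-- The graphical derivative of `F` at `(x, y)`: the set-valued map whose graph is the tangent cone
of the graph of `F` at `(x, y)`. -/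
def graphicalDeriv (F : X → Set Y) (x : X) (y : Y) : X → Set Y :=
  fun u => {w | (u, w) ∈ tangentCone (graph F) (x, y)}

/-- A convex process: a set-valued map whose graph is a closed convex cone
(containing the origin). -/
structure IsConvexProcess (T : X → Set Y) : Prop where
  isClosed : IsClosed (graph T)
  convex : Convex ℝ (graph T)
  zero_mem : (0 : X × Y) ∈ graph T
  smul_mem : ∀ c : ℝ, 0 < c → ∀ z ∈ graph T, c • z ∈ graph T

/-- Differentiability of a set-valued map with closed graph at a point of its graph: the graphical
derivative there is a convex process. -/
structure IsDifferentiableAt (F : X → Set Y) (x : X) (y : Y) : Prop where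
  isClosed_graph : IsClosed (graph F)
  mem_graph : (x, y) ∈ graph F
  isConvexProcess : IsConvexProcess (graphicalDeriv F x y)

/-- The support function `p ↦ max_{y ∈ K} ⟪p, y⟫` of `K`. -/
def supportFun (K : Set Y) (p : Y) : ℝ := sSup ((fun y => ⟪p, y⟫) '' K)

/-- The set of points of `K` at which `⟪p, ·⟫` attains its maximum over `K`. -/
def face (K : Set Y) (p : Y) : Set Y := {y | y ∈ K ∧ ⟪p, y⟫ = supportFun K p}

/-- The normal cone (of convex analysis) of `K` at `y`. -/
def normalCone (K : Set Y) (y : Y) : Set Y := {q | ∀ z ∈ K, ⟪q, z - y⟫ ≤ 0}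

/-- Local isotropic Lipschitz continuity of a set-valued map. -/
def IsLocallyIsotropicallyLipschitz (F : X → Set Y) : Prop :=
  ∀ x₀ : X, ∃ k : ℝ, 0 < k ∧ ∃ U ∈ 𝓝 x₀, ∀ p : Y, ∀ x ∈ U, ∀ x' ∈ U,
    face (F x) p ⊆ face (F x') p + (k * ‖x - x'‖) • Metric.closedBall (0 : Y) 1

end

end SetValuedMap

end

/-! Isotropic Lipschitz continuity makes `σ_{F(x)} - σ_{F(x')}` a Lipschitz function of `p` with
constant `k‖x - x'‖` (`supportFun_sub_supportFun_le`). This is used twice. Rademacher's theorem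
gives differentiability in `x` for a countable dense set of `p`, and the estimate extends it to all
`p` outside a single null set (`ae_forall_differentiableAt_supportFun`). At such an `x`, let `y`
have a unique unit normal `p`. Points of the graph satisfy `⟪p, ·⟫ ≤ σ`, so the tangent cone lies in
the half-space. Conversely, if `⟪p, w⟫ < φ u` and `y + h w ∉ F (x + h u)` along some `h → 0`,
separating unit vectors subconverge to a normal at `y`, hence to `p`; the estimate replaces them by
`p` at cost `o(h)`, a contradiction (`tangentCone_graph_eq`). Almost every boundary point has a
unique unit normal: two normals span a planar cone which, translated to `y`, meets a rational
coordinate plane of codimension two, and `y` is the metric projection of the meeting point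
(`hausdorffMeasure_setOf_two_normals`). -/

namespace SetValuedMap

/-! ### Support functions under isotropic Lipschitz perturbation. -/

section

variable {X Y : Type*} [NormedAddCommGroup X] [InnerProductSpace ℝ X]
  [NormedAddCommGroup Y] [InnerProductSpace ℝ Y]

theorem inner_le_supportFun {K : Set Y} (hK : IsCompact K) {y : Y} (hy : y ∈ K) (p : Y) :
    ⟪p, y⟫ ≤ supportFun K p :=
  le_csSup (hK.image (by fun_prop)).bddAbove ⟨y, hy, rfl⟩

theorem supportFun_le {K : Set Y} (hne : K.Nonempty) {p : Y} {c : ℝ}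
    (h : ∀ y ∈ K, ⟪p, y⟫ ≤ c) : supportFun K p ≤ c :=
  csSup_le (hne.image _) (by rintro _ ⟨y, hy, rfl⟩; exact h y hy)

theorem face_nonempty {K : Set Y} (hK : IsCompact K) (hne : K.Nonempty) (p : Y) :
    (face K p).Nonempty := by
  obtain ⟨y, hy, h⟩ := (hK.image (f := fun y => ⟪p, y⟫) (by fun_prop)).sSup_mem (hne.image _)
  exact ⟨y, hy, h⟩

theorem face_zero {K : Set Y} (hne : K.Nonempty) : face K (0 : Y) = K := by
  ext y
  simp [face, supportFun, hne.image_const]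

/-- A point outside a compact convex set is separated from it by a unit vector. -/
theorem exists_supportFun_lt_of_notMem [CompleteSpace Y] {K : Set Y} (hK : IsCompact K)
    (hc : Convex ℝ K) (hne : K.Nonempty) {y : Y} (hy : y ∉ K) :
    ∃ q : Y, ‖q‖ = 1 ∧ supportFun K q < ⟪q, y⟫ := by
  obtain ⟨f, u, hf, hu⟩ := geometric_hahn_banach_closed_point hc hK.isClosed hy
  set g := (InnerProductSpace.toDual ℝ Y).symm f with hg
  have hgf : ∀ z, ⟪g, z⟫ = f z := fun z => InnerProductSpace.toDual_symm_apply
  have hg0 : g ≠ 0 := by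
    intro h0
    obtain ⟨z, hz⟩ := hne
    have h1 := hf z hz
    rw [← hgf, h0, inner_zero_left] at h1 hu
    linarith
  have hpos : 0 < ‖g‖⁻¹ := inv_pos.2 (norm_pos_iff.2 hg0)
  refine ⟨‖g‖⁻¹ • g, norm_smul_inv_norm (𝕜 := ℝ) hg0, ?_⟩
  refine (supportFun_le hne (c := ‖g‖⁻¹ * u) fun z hz => ?_).trans_lt ?_
  · rw [real_inner_smul_left, hgf]
    exact mul_le_mul_of_nonneg_left (hf z hz).le hpos.le
  · rw [real_inner_smul_left, hgf]
    exact mul_lt_mul_of_pos_left hu hpos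

/-- If the faces of `K` are uniformly close to those of `K'`, the difference of the two support
functions is Lipschitz. -/
theorem supportFun_sub_supportFun_le {K K' : Set Y} (hK : IsCompact K) (hK' : IsCompact K')
    (hne : K.Nonempty) {r : ℝ} (hr : 0 ≤ r)
    (h : ∀ p, face K p ⊆ face K' p + r • Metric.closedBall (0 : Y) 1) (p q : Y) :
    (supportFun K p - supportFun K' p) - (supportFun K q - supportFun K' q) ≤ r * ‖p - q‖ := by
  choose a ha using face_nonempty hK hne
  have hb : ∀ p, ∃ b ∈ face K' p, ‖a p - b‖ ≤ r := by
    intro p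
    obtain ⟨b, hb, c, hc, hbc⟩ := Set.mem_add.1 (h p (ha p))
    refine ⟨b, hb, ?_⟩
    obtain ⟨e, he, rfl⟩ := Set.mem_smul_set.1 hc
    rw [← hbc, add_sub_cancel_left, norm_smul, Real.norm_of_nonneg hr]
    have : ‖e‖ ≤ 1 := by simpa using he
    nlinarith
  choose b hb hab using hb
  set D : Y → ℝ := fun p => supportFun K p - supportFun K' p with hD
  -- Test `a p` in direction `q` and `b q` in direction `p`; the last term is the excess to be
  -- removed.
  have key : ∀ p q, D p - D q ≤ r * ‖p - q‖ + ⟪p - q, b p - b q⟫ := by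
    intro p q
    have h1 := (ha p).2
    have h2 := inner_le_supportFun hK (ha p).1 q
    have h3 := (hb q).2
    have h4 := inner_le_supportFun hK' (hb q).1 p
    have h5 : ⟪p - q, a p - b p⟫ ≤ r * ‖p - q‖ := by
      refine (real_inner_le_norm _ _).trans ?_
      rw [mul_comm]
      exact mul_le_mul_of_nonneg_right (hab p) (norm_nonneg _)
    have h6 : D p - D q ≤ ⟪p - q, a p - b q⟫ := by
      simp only [hD, inner_sub_left, inner_sub_right]
      linarith
    have h7 : ⟪p - q, a p - b q⟫ = ⟪p - q, a p - b p⟫ + ⟪p - q, b p - b q⟫ := by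
      rw [← inner_add_right]; congr 1; abel
    linarith
  -- Summing `key` over `n + 1` equal pieces of the segment from `q` to `p`, the excess terms
  -- telescope and keep only a factor `1 / (n + 1)`.
  have sub : ∀ n : ℕ, D p - D q ≤ r * ‖p - q‖ + ⟪p - q, b p - b q⟫ / ((n : ℝ) + 1) := by
    intro n
    set N : ℝ := (n : ℝ) + 1 with hN
    have hNpos : 0 < N := by positivity
    set s : ℕ → Y := fun i => q + ((i : ℝ) / N) • (p - q) with hs
    have hs0 : s 0 = q := by simp [hs]
    have hsN : s (n + 1) = p := by
      have : (((n + 1 : ℕ) : ℝ)) / N = 1 := by rw [hN]; push_cast; exact div_self hNpos.ne'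
      simp only [hs, this, one_smul, add_sub_cancel]
    have hstep : ∀ i, s (i + 1) - s i = N⁻¹ • (p - q) := by
      intro i
      simp only [hs, add_sub_add_left_eq_sub, ← sub_smul]
      congr 1
      push_cast
      field_simp
      ring
    have hi : ∀ i, D (s (i + 1)) - D (s i) ≤
        N⁻¹ * (r * ‖p - q‖) + N⁻¹ * (⟪p - q, b (s (i + 1))⟫ - ⟪p - q, b (s i)⟫) := by
      intro i
      refine (key (s (i + 1)) (s i)).trans_eq ?_
      rw [hstep, norm_smul, real_inner_smul_left, inner_sub_right,
        Real.norm_of_nonneg (inv_pos.2 hNpos).le]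
      ring
    have hsum := Finset.sum_le_sum fun i (_ : i ∈ Finset.range (n + 1)) => hi i
    rw [Finset.sum_range_sub (fun i => D (s i)), Finset.sum_add_distrib, Finset.sum_const,
      ← Finset.mul_sum, Finset.sum_range_sub (fun i => ⟪p - q, b (s i)⟫), hs0, hsN,
      Finset.card_range, nsmul_eq_mul] at hsum
    refine hsum.trans_eq ?_
    rw [inner_sub_right, hN]
    push_cast
    field_simp
  have hlim : Tendsto (fun n : ℕ => r * ‖p - q‖ + ⟪p - q, b p - b q⟫ / ((n : ℝ) + 1)) atTop
      (𝓝 (r * ‖p - q‖ + 0)) :=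
    tendsto_const_nhds.add
      (tendsto_const_nhds.div_atTop (tendsto_natCast_atTop_atTop.atTop_add tendsto_const_nhds))
  rw [add_zero] at hlim
  exact ge_of_tendsto' hlim sub

theorem supportFun_zero {K : Set Y} (hne : K.Nonempty) : supportFun K (0 : Y) = 0 := by
  simp [supportFun, hne.image_const]

theorem supportFun_sub_le_norm {K K' : Set Y} (hK : IsCompact K) (hK' : IsCompact K')
    (hne : K.Nonempty) (hne' : K'.Nonempty) {r : ℝ} (hr : 0 ≤ r)
    (h : ∀ p, face K p ⊆ face K' p + r • Metric.closedBall (0 : Y) 1) (p : Y) :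
    supportFun K p - supportFun K' p ≤ r * ‖p‖ := by
  simpa [supportFun_zero hne, supportFun_zero hne'] using
    supportFun_sub_supportFun_le hK hK' hne hr h p 0

/-! ### The closed graph and its tangent cones. -/

omit [InnerProductSpace ℝ X] in
theorem isClosed_graph {F : X → Set Y} (hcompact : ∀ x, IsCompact (F x))
    (hne : ∀ x, (F x).Nonempty) (hF : IsLocallyIsotropicallyLipschitz F) :
    IsClosed (graph F) := by
  refine IsSeqClosed.isClosed ?_
  intro z a hz hza
  obtain ⟨k, hk, U, hU, h⟩ := hF a.1
  have hz1 : Tendsto (fun n => (z n).1) atTop (𝓝 a.1) := hza.fst_nhds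
  have hz2 : Tendsto (fun n => (z n).2) atTop (𝓝 a.2) := hza.snd_nhds
  have hev : ∀ᶠ n in atTop, Metric.infDist (z n).2 (F a.1) ≤ k * ‖(z n).1 - a.1‖ := by
    filter_upwards [hz1 hU] with n hn
    -- In direction `0` the face is the whole set, so `F` itself is locally Lipschitz.
    have h1 := h 0 _ hn _ (mem_of_mem_nhds hU)
    rw [face_zero (hne _), face_zero (hne _)] at h1
    obtain ⟨b, hb, c, hc, hbc⟩ := Set.mem_add.1 (h1 (hz n))
    obtain ⟨e, he, rfl⟩ := Set.mem_smul_set.1 hc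
    refine (Metric.infDist_le_dist_of_mem hb).trans ?_
    rw [← hbc, dist_eq_norm, add_sub_cancel_left, norm_smul, Real.norm_of_nonneg (by positivity)]
    have : ‖e‖ ≤ 1 := by simpa using he
    exact mul_le_of_le_one_right (by positivity) this
  have hl : Tendsto (fun n => Metric.infDist (z n).2 (F a.1)) atTop
      (𝓝 (Metric.infDist a.2 (F a.1))) :=
    ((Metric.continuous_infDist_pt _).tendsto _).comp hz2
  have hr : Tendsto (fun n => k * ‖(z n).1 - a.1‖) atTop (𝓝 (k * ‖a.1 - a.1‖)) :=
    (hz1.sub_const _).norm.const_mul k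
  have h0 : Metric.infDist a.2 (F a.1) = 0 := by
    have := le_of_tendsto_of_tendsto hl hr hev
    rw [sub_self, norm_zero, mul_zero] at this
    exact le_antisymm this Metric.infDist_nonneg
  exact ((hcompact a.1).isClosed.mem_iff_infDist_zero (hne _)).2 h0

/-- At a point with a unique unit normal `p`, the tangent cone to the graph is the half-space given
by the derivative of the support function in direction `p`. -/
theorem tangentCone_graph_eq [FiniteDimensional ℝ Y] {F : X → Set Y}
    (hcompact : ∀ x, IsCompact (F x)) (hconvex : ∀ x, Convex ℝ (F x))
    (hne : ∀ x, (F x).Nonempty) (hF : IsLocallyIsotropicallyLipschitz F) {x : X} {y p : Y}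
    (hy : y ∈ F x) (hp : normalCone (F x) y ∩ Metric.sphere 0 1 = {p}) {φ : X →L[ℝ] ℝ}
    (hφ : HasFDerivAt (fun x' => supportFun (F x') p) φ x) :
    tangentCone (graph F) (x, y) = {z | ⟪p, z.2⟫ ≤ φ z.1} := by
  have : CompleteSpace Y := FiniteDimensional.complete ℝ Y
  have hpmem : p ∈ normalCone (F x) y ∩ Metric.sphere 0 1 := hp ▸ Set.mem_singleton p
  have hpnorm : ‖p‖ = 1 := by simpa using hpmem.2
  have hpy : supportFun (F x) p = ⟪p, y⟫ := by
    refine le_antisymm (supportFun_le (hne x) fun z hz => ?_) (inner_le_supportFun (hcompact x) hy p)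
    have := hpmem.1 z hz
    rw [inner_sub_right] at this
    linarith
  have hquot : ∀ (h : ℕ → ℝ) (v : ℕ → X) (u : X), (∀ n, 0 < h n) → Tendsto h atTop (𝓝 0) →
      Tendsto v atTop (𝓝 u) → Tendsto (fun n => (h n)⁻¹ *
        (supportFun (F (x + h n • v n)) p - supportFun (F x) p)) atTop (𝓝 (φ u)) := by
    intro h v u hpos h0 hv
    refine (hasFDerivWithinAt_univ.2 hφ).lim (c := fun n => (h n)⁻¹) (d := fun n => h n • v n)
      ?_ (Eventually.of_forall fun _ => Set.mem_univ _) ?_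
    · simpa using h0.smul hv
    · refine hv.congr fun n => ?_
      rw [smul_smul, inv_mul_cancel₀ (hpos n).ne', one_smul]
  obtain ⟨k, hk, U, hU, hL⟩ := hF x
  have strict : ∀ u w, ⟪p, w⟫ < φ u →
      ∀ᶠ h : ℝ in 𝓝[>] 0, y + h • w ∈ F (x + h • u) := by
    intro u w huw
    by_contra hcon
    have hfreq : ∃ᶠ h : ℝ in 𝓝[>] 0, (y + h • w ∉ F (x + h • u)) ∧ x + h • u ∈ U ∧ 0 < h := by
      refine (not_eventually.1 hcon).and_eventually (.and ?_ self_mem_nhdsWithin)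
      have : Tendsto (fun h : ℝ => x + h • u) (𝓝[>] 0) (𝓝 x) := by
        have hc : Continuous fun h : ℝ => x + h • u := by fun_prop
        simpa using (hc.tendsto 0).mono_left nhdsWithin_le_nhds
      exact this hU
    obtain ⟨h, hh, hmem⟩ := exists_seq_forall_of_frequently hfreq
    choose q hq1 hq using fun n =>
      exists_supportFun_lt_of_notMem (hcompact _) (hconvex _) (hne _) (hmem n).1
    obtain ⟨q', hq', ψ, hψ, hqψ⟩ := (isCompact_sphere (0 : Y) 1).tendsto_subseq
      (x := q) (fun n => by simpa using hq1 n)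
    have hh0 : Tendsto (fun n => h (ψ n)) atTop (𝓝 0) :=
      (hh.mono_right nhdsWithin_le_nhds).comp hψ.tendsto_atTop
    have hxU := mem_of_mem_nhds hU
    have hnorm : ∀ n, ‖x - (x + h n • u)‖ = h n * ‖u‖ := fun n => by
      rw [sub_add_cancel_left, norm_neg, norm_smul, Real.norm_of_nonneg (hmem n).2.2.le]
    have hlower : ∀ n (e : Y), supportFun (F x) (q n) - supportFun (F (x + h n • u)) (q n) -
        (supportFun (F x) e - supportFun (F (x + h n • u)) e) ≤ k * (h n * ‖u‖) * ‖q n - e‖ := by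
      intro n e
      have := supportFun_sub_supportFun_le (hcompact x) (hcompact (x + h n • u)) (hne x)
        (r := k * ‖x - (x + h n • u)‖) (by positivity)
        (fun p => hL p x hxU _ (hmem n).2.1) (q n) e
      rwa [hnorm] at this
    have hq'p : q' = p := by
      have : q' ∈ normalCone (F x) y ∩ Metric.sphere 0 1 := by
        refine ⟨fun z hz => ?_, hq'⟩
        have hl : Tendsto (fun n => ⟪q (ψ n), z - y⟫) atTop (𝓝 ⟪q', z - y⟫) :=
          hqψ.inner tendsto_const_nhds
        have hr : Tendsto (fun n => h (ψ n) * ⟪q (ψ n), w⟫ + k * (h (ψ n) * ‖u‖)) atTop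
            (𝓝 (0 * ⟪q', w⟫ + k * (0 * ‖u‖))) :=
          (hh0.mul (hqψ.inner tendsto_const_nhds)).add ((hh0.mul_const _).const_mul k)
        simp only [zero_mul, mul_zero, add_zero] at hr
        refine le_of_tendsto_of_tendsto' hl hr fun n => ?_
        -- At `e = 0` both support functions vanish, so `q (ψ n)` is normal at `y` up to `O(h)`.
        have h1 := hlower (ψ n) 0
        have h2 := hq (ψ n)
        have h3 := inner_le_supportFun (hcompact x) hz (q (ψ n))
        rw [supportFun_zero (hne _), supportFun_zero (hne _), sub_zero, sub_zero, sub_zero, hq1,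
          mul_one] at h1
        rw [inner_add_right, real_inner_smul_right] at h2
        rw [inner_sub_right]
        linarith
      rw [hp] at this
      exact this
    subst hq'p
    have hl := hquot (fun n => h (ψ n)) (fun _ => u) u (fun n => (hmem _).2.2) hh0
      tendsto_const_nhds
    have hr : Tendsto (fun n => ⟪q (ψ n), w⟫ + k * ‖u‖ * ‖q (ψ n) - q'‖) atTop
        (𝓝 (⟪q', w⟫ + k * ‖u‖ * ‖q' - q'‖)) :=
      (hqψ.inner tendsto_const_nhds).add ((hqψ.sub_const q').norm.const_mul _)
    rw [sub_self, norm_zero, mul_zero, add_zero] at hr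
    refine absurd (le_of_tendsto_of_tendsto' hl hr fun n => ?_) (not_le.2 huw)
    have hpos := (hmem (ψ n)).2.2
    -- Moving the direction from `q (ψ n)` to its limit costs `h * k‖u‖‖q (ψ n) - q'‖`, which is
    -- `o(h)`.
    have h1 := hlower (ψ n) q'
    have h2 := hq (ψ n)
    have h3 := inner_le_supportFun (hcompact x) hy (q (ψ n))
    rw [inner_add_right, real_inner_smul_right] at h2
    rw [inv_mul_le_iff₀ hpos]
    linarith
  ext ⟨u, w⟩
  constructor
  · rintro ⟨h, v, hpos, h0, hv, hmem⟩
    have hl : Tendsto (fun n => ⟪p, (v n).2⟫) atTop (𝓝 ⟪p, w⟫) :=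
      tendsto_const_nhds.inner hv.snd_nhds
    refine le_of_tendsto_of_tendsto' hl (hquot h (fun n => (v n).1) u hpos h0 hv.fst_nhds)
      fun n => ?_
    rw [le_inv_mul_iff₀ (hpos n)]
    have h1 : y + h n • (v n).2 ∈ F (x + h n • (v n).1) := hmem n
    have h2 := inner_le_supportFun (hcompact _) h1 p
    rw [inner_add_right, real_inner_smul_right] at h2
    linarith
  · intro huw
    replace huw : ⟪p, w⟫ ≤ φ u := huw
    -- Shifting `w` by `-p / (n + 1)` makes the inequality strict, since `‖p‖ = 1`.
    have hex : ∀ n : ℕ, ∃ h : ℝ, 0 < h ∧ h < 1 / ((n : ℝ) + 1) ∧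
        y + h • (w - (1 / ((n : ℝ) + 1)) • p) ∈ F (x + h • u) := by
      intro n
      have hn : (0 : ℝ) < 1 / ((n : ℝ) + 1) := by positivity
      have h1 : ⟪p, w - (1 / ((n : ℝ) + 1)) • p⟫ < φ u := by
        rw [inner_sub_right, real_inner_smul_right, real_inner_self_eq_norm_sq, hpnorm]
        linarith
      obtain ⟨h, hh1, hh2, hh3⟩ :=
        ((strict u _ h1).and ((Ioo_mem_nhdsGT hn : ∀ᶠ h in 𝓝[>] (0 : ℝ), h ∈ Set.Ioo 0 _))).exists
      exact ⟨h, hh2, hh3, hh1⟩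
    choose h hpos hlt hmem using hex
    refine ⟨h, fun n => (u, w - (1 / ((n : ℝ) + 1)) • p), hpos, ?_, ?_, hmem⟩
    · exact squeeze_zero (fun n => (hpos n).le) (fun n => (hlt n).le)
        tendsto_one_div_add_atTop_nhds_zero_nat
    · refine tendsto_const_nhds.prodMk_nhds ?_
      simpa using (tendsto_const_nhds (x := w)).sub
        ((tendsto_one_div_add_atTop_nhds_zero_nat (𝕜 := ℝ)).smul_const p)

end

end SetValuedMap

/-! ### Simultaneous differentiability of the support functions. -/

namespace SetValuedMap

/-- A function approximated to first order at `x`, up to arbitrarily small Lipschitz errors, by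
functions differentiable at `x` is differentiable at `x`. -/
theorem differentiableAt_of_approx {X : Type*} [NormedAddCommGroup X] [NormedSpace ℝ X]
    {f : X → ℝ} {g : ℕ → X → ℝ} {x : X} {ε : ℕ → ℝ} (hε0 : ∀ n, 0 ≤ ε n)
    (hε : Tendsto ε atTop (𝓝 0)) (hg : ∀ n, DifferentiableAt ℝ (g n) x)
    (h : ∀ n, ∀ᶠ x' in 𝓝 x, |(f x' - f x) - (g n x' - g n x)| ≤ ε n * ‖x' - x‖) :
    DifferentiableAt ℝ f x := by
  set φ : ℕ → X →L[ℝ] ℝ := fun n => fderiv ℝ (g n) x with hφ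
  have hφg : ∀ n, HasFDerivAt (g n) (φ n) x := fun n => (hg n).hasFDerivAt
  have hdist : ∀ n m, ‖φ n - φ m‖ ≤ ε n + ε m := by
    intro n m
    refine ((hφg n).sub (hφg m)).le_of_lip' (add_nonneg (hε0 n) (hε0 m)) ?_
    filter_upwards [h n, h m] with x' hn hm
    rw [Real.norm_eq_abs, add_mul]
    rw [abs_le] at *
    simp only [Pi.sub_apply]
    constructor <;> linarith [hn.1, hn.2, hm.1, hm.2]
  have hcauchy : CauchySeq φ := by
    refine Metric.cauchySeq_iff.2 fun δ hδ => ?_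
    obtain ⟨N, hN⟩ := eventually_atTop.1 (hε.eventually (gt_mem_nhds (half_pos hδ)))
    refine ⟨N, fun m hm n hn => ?_⟩
    rw [dist_eq_norm]
    linarith [hdist m n, hN m hm, hN n hn]
  obtain ⟨ψ, hψ⟩ := cauchySeq_tendsto_of_complete hcauchy
  refine ⟨ψ, HasFDerivAt.of_isLittleO (Asymptotics.isLittleO_iff.2 fun c hc => ?_)⟩
  have hψ' : Tendsto (fun n => ‖φ n - ψ‖) atTop (𝓝 0) := by
    simpa using (hψ.sub_const ψ).norm
  obtain ⟨n, hn1, hn2⟩ := ((hε.eventually (gt_mem_nhds (show 0 < c / 3 by positivity))).and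
    (hψ'.eventually (gt_mem_nhds (show 0 < c / 3 by positivity)))).exists
  filter_upwards [h n, Asymptotics.isLittleO_iff.1 (hφg n).isLittleO
    (show 0 < c / 3 by positivity)] with x' h1 h2
  have h3 := (φ n - ψ).le_opNorm (x' - x)
  rw [sub_apply] at h3
  have h4 : ε n * ‖x' - x‖ ≤ c / 3 * ‖x' - x‖ :=
    mul_le_mul_of_nonneg_right hn1.le (norm_nonneg _)
  have h5 : ‖φ n - ψ‖ * ‖x' - x‖ ≤ c / 3 * ‖x' - x‖ :=
    mul_le_mul_of_nonneg_right hn2.le (norm_nonneg _)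
  rw [Real.norm_eq_abs, abs_le] at *
  constructor <;> linarith [h1.1, h1.2, h2.1, h2.2, h3.1, h3.2]

section

variable {X Y : Type*} [NormedAddCommGroup X] [InnerProductSpace ℝ X]
  [NormedAddCommGroup Y] [InnerProductSpace ℝ Y] {F : X → Set Y}

omit [InnerProductSpace ℝ X] in
theorem exists_lipschitzOnWith_supportFun (hcompact : ∀ x, IsCompact (F x))
    (hne : ∀ x, (F x).Nonempty) (hF : IsLocallyIsotropicallyLipschitz F) (x : X) (p : Y) :
    ∃ C, ∃ U ∈ 𝓝 x, LipschitzOnWith C (fun x' => supportFun (F x') p) U := by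
  obtain ⟨k, hk, U, hU, hL⟩ := hF x
  refine ⟨(k * ‖p‖).toNNReal, U, hU, LipschitzOnWith.of_le_add_mul' _ fun a ha b hb => ?_⟩
  have := supportFun_sub_le_norm (hcompact a) (hcompact b) (hne a) (hne b)
    (r := k * ‖a - b‖) (by positivity) (fun q => hL q a ha b hb) p
  rw [dist_eq_norm]
  linarith

theorem ae_differentiableAt_supportFun [FiniteDimensional ℝ X] [MeasurableSpace X] [BorelSpace X]
    (μ : Measure X) [μ.IsAddHaarMeasure] (hcompact : ∀ x, IsCompact (F x))
    (hne : ∀ x, (F x).Nonempty) (hF : IsLocallyIsotropicallyLipschitz F) (p : Y) :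
    ∀ᵐ x ∂μ, DifferentiableAt ℝ (fun x' => supportFun (F x') p) x := by
  refine measure_null_of_locally_null _ fun x _ => ?_
  obtain ⟨C, U, hU, hL⟩ := exists_lipschitzOnWith_supportFun hcompact hne hF x p
  -- On the interior, Rademacher's differentiability within `U` is full differentiability.
  refine ⟨_ ∩ interior U, inter_mem_nhdsWithin _ (interior_mem_nhds.2 hU), ?_⟩
  refine measure_mono_null ?_ (hL.ae_differentiableWithinAt_of_mem (μ := μ))
  rintro z ⟨hz, hzU⟩ hd
  exact hz ((hd (interior_subset hzU)).differentiableAt (mem_interior_iff_mem_nhds.1 hzU))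

/-- Outside a null set of points, all the support functions are differentiable simultaneously. -/
theorem ae_forall_differentiableAt_supportFun [FiniteDimensional ℝ X] [MeasurableSpace X]
    [BorelSpace X] [TopologicalSpace.SeparableSpace Y] (μ : Measure X) [μ.IsAddHaarMeasure]
    (hcompact : ∀ x, IsCompact (F x)) (hne : ∀ x, (F x).Nonempty)
    (hF : IsLocallyIsotropicallyLipschitz F) :
    ∀ᵐ x ∂μ, ∀ p : Y, DifferentiableAt ℝ (fun x' => supportFun (F x') p) x := by
  have hae : ∀ᵐ x ∂μ, ∀ n : ℕ, DifferentiableAt ℝ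
      (fun x' => supportFun (F x') (TopologicalSpace.denseSeq Y n)) x :=
    ae_all_iff.2 fun n => ae_differentiableAt_supportFun μ hcompact hne hF _
  filter_upwards [hae] with x hx p
  obtain ⟨s, hs, hsp⟩ := mem_closure_iff_seq_limit.1 (TopologicalSpace.denseRange_denseSeq Y p)
  obtain ⟨k, hk, U, hU, hL⟩ := hF x
  refine differentiableAt_of_approx (g := fun n x' => supportFun (F x') (s n))
    (ε := fun n => k * ‖p - s n‖) (fun n => by positivity) ?_ (fun n => ?_) fun n => ?_
  · simpa using (hsp.const_sub p).norm.const_mul k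
  · obtain ⟨m, hm⟩ := hs n
    simpa only [hm] using hx m
  · filter_upwards [hU] with x' hx'
    have hxU := mem_of_mem_nhds hU
    have h1 := supportFun_sub_supportFun_le (hcompact x') (hcompact x) (hne x')
      (r := k * ‖x' - x‖) (by positivity) (fun q => hL q x' hx' x hxU) p (s n)
    have h2 := supportFun_sub_supportFun_le (hcompact x') (hcompact x) (hne x')
      (r := k * ‖x' - x‖) (by positivity) (fun q => hL q x' hx' x hxU) (s n) p
    rw [norm_sub_rev (s n)] at h2
    rw [abs_le, mul_right_comm]
    constructor <;> linarith

/-! ### Boundary points with more than one unit normal. -/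

/-- Points whose normal cones meet a Hausdorff null set form a null set, since the metric
projection is a contraction. -/
theorem hausdorffMeasure_normal_foot_eq_zero [MeasurableSpace Y] [BorelSpace Y] (K : Set Y)
    {L : Set Y} {s : ℝ} (hs : 0 ≤ s) (hL : μH[s] L = 0) :
    μH[s] {y | y ∈ K ∧ ∃ z ∈ L, z - y ∈ normalCone K y} = 0 := by
  have hcontr : ∀ {y z y' z' : Y}, y ∈ K → z - y ∈ normalCone K y → y' ∈ K →
      z' - y' ∈ normalCone K y' → ‖y - y'‖ ≤ ‖z - z'‖ := by
    intro y z y' z' hy hz hy' hz'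
    have h1 := hz y' hy'
    have h2 := hz' y hy
    have h3 := real_inner_le_norm (z - z') (y - y')
    have h4 := real_inner_self_eq_norm_sq (y - y')
    simp only [inner_sub_left, inner_sub_right] at h1 h2 h3 h4
    by_contra! hlt
    have h5 : ‖z - z'‖ * ‖y - y'‖ < ‖y - y'‖ ^ 2 := by
      rw [sq]
      exact mul_lt_mul_of_pos_right hlt ((norm_nonneg _).trans_lt hlt)
    linarith [real_inner_comm y y']
  have hex : ∀ z, ∃ y, (∃ y' ∈ K, z - y' ∈ normalCone K y') → y ∈ K ∧ z - y ∈ normalCone K y := by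
    intro z
    by_cases h : ∃ y' ∈ K, z - y' ∈ normalCone K y'
    · obtain ⟨y, hy⟩ := h
      exact ⟨y, fun _ => hy⟩
    -- Arbitrary value: `g` is only used on `A`, where a foot exists.
    · exact ⟨z, fun h' => absurd h' h⟩
  choose g hg using hex
  set A : Set Y := {z | z ∈ L ∧ ∃ y' ∈ K, z - y' ∈ normalCone K y'}
  have hlip : LipschitzOnWith 1 g A := by
    refine LipschitzOnWith.of_dist_le_mul fun z hz z' hz' => ?_
    rw [NNReal.coe_one, one_mul, dist_eq_norm, dist_eq_norm]
    exact hcontr (hg z hz.2).1 (hg z hz.2).2 (hg z' hz'.2).1 (hg z' hz'.2).2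
  have hgA : μH[s] (g '' A) = 0 := by
    have h1 := hlip.hausdorffMeasure_image_le hs
    have hA0 : μH[s] A = 0 := measure_mono_null (fun z hz => hz.1) hL
    rw [hA0, mul_zero] at h1
    exact le_antisymm h1 bot_le
  refine measure_mono_null ?_ hgA
  rintro y ⟨hy, z, hz, hzy⟩
  have hzA : z ∈ A := ⟨hz, y, hy, hzy⟩
  refine ⟨z, hzA, ?_⟩
  have h1 := hcontr (hg z hzA.2).1 (hg z hzA.2).2 hy hzy
  rw [sub_self, norm_zero] at h1
  exact sub_eq_zero.1 (norm_le_zero_iff.1 h1)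

theorem smul_add_smul_mem_normalCone {K : Set Y} {y p q : Y} (hp : p ∈ normalCone K y)
    (hq : q ∈ normalCone K y) {a b : ℝ} (ha : 0 ≤ a) (hb : 0 ≤ b) :
    a • p + b • q ∈ normalCone K y := by
  intro z hz
  rw [inner_add_left, real_inner_smul_left, real_inner_smul_left]
  exact add_nonpos (mul_nonpos_of_nonneg_of_nonpos ha (hp z hz))
    (mul_nonpos_of_nonneg_of_nonpos hb (hq z hz))

/-- The normal cones of a set with nonempty interior contain no line. -/
theorem neg_notMem_normalCone {K : Set Y} (hK : (interior K).Nonempty) {y p : Y} (hp0 : p ≠ 0)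
    (hp : p ∈ normalCone K y) : -p ∉ normalCone K y := by
  intro hn
  obtain ⟨z, hz⟩ := hK
  have hzero : ∀ w ∈ K, ⟪p, w - y⟫ = 0 := fun w hw => by
    have h1 := hn w hw
    rw [inner_neg_left] at h1
    linarith [hp w hw]
  have hcont : Tendsto (fun t : ℝ => z + t • p) (𝓝[>] 0) (𝓝 z) := by
    have hc : Continuous fun t : ℝ => z + t • p := by fun_prop
    simpa using (hc.tendsto 0).mono_left nhdsWithin_le_nhds
  obtain ⟨t, ht, htpos⟩ :=
    ((hcont.eventually_mem (mem_interior_iff_mem_nhds.1 hz)).and self_mem_nhdsWithin).exists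
  have h1 := hzero _ ht
  have h2 := hzero _ (interior_subset hz)
  rw [add_sub_right_comm, inner_add_right, h2, real_inner_smul_right, zero_add,
    real_inner_self_eq_norm_sq] at h1
  have : 0 < t * ‖p‖ ^ 2 := mul_pos htpos (by positivity)
  linarith

theorem exists_unit_mem_normalCone [CompleteSpace Y] {K : Set Y} (hc : Convex ℝ K)
    (hK : (interior K).Nonempty) {y : Y} (hy : y ∈ frontier K) :
    ∃ p ∈ normalCone K y, ‖p‖ = 1 := by
  obtain ⟨f, hf⟩ := geometric_hahn_banach_open_point hc.interior isOpen_interior hy.2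
  set g := (InnerProductSpace.toDual ℝ Y).symm f with hg
  have hgf : ∀ z, ⟪g, z⟫ = f z := fun z => InnerProductSpace.toDual_symm_apply
  have hg0 : g ≠ 0 := by
    intro h0
    obtain ⟨z, hz⟩ := hK
    have h1 := hf z hz
    rw [← hgf, ← hgf, h0, inner_zero_left, inner_zero_left] at h1
    exact lt_irrefl _ h1
  refine ⟨‖g‖⁻¹ • g, fun z hz => ?_, norm_smul_inv_norm (𝕜 := ℝ) hg0⟩
  have hle : f z ≤ f y := by
    have hcl : z ∈ closure (interior K) := by
      rw [hc.closure_interior_eq_closure_of_nonempty_interior hK]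
      exact subset_closure hz
    exact closure_minimal (fun w hw => (hf w hw).le)
      (isClosed_le f.continuous continuous_const) hcl
  rw [real_inner_smul_left, inner_sub_right, hgf, hgf]
  exact mul_nonpos_of_nonneg_of_nonpos (by positivity) (by linarith)

end

section Euclidean

variable {l : ℕ}

theorem two_le_of_ne {i j : Fin l} (hij : i ≠ j) : 2 ≤ l := by
  have h1 := i.isLt
  have h2 := j.isLt
  have h3 : (i : ℕ) ≠ j := fun h => hij (Fin.ext h)
  omega

/-- Coordinate planes of codimension two are null for the Hausdorff measure of codimension one. -/
theorem hausdorffMeasure_coordinatePlane {i j : Fin l} (hij : i ≠ j) (r t : ℝ) :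
    (μH[(l : ℝ) - 1] : Measure (EuclideanSpace ℝ (Fin l))) {z | z i = r ∧ z j = t} = 0 := by
  have hl := two_le_of_ne hij
  have hl' : (2 : ℝ) ≤ l := by exact_mod_cast hl
  rcases Set.eq_empty_or_nonempty {z : EuclideanSpace ℝ (Fin l) | z i = r ∧ z j = t} with
    h0 | ⟨z₀, hz₀⟩
  · rw [h0, measure_empty]
  set T : EuclideanSpace ℝ (Fin l) →ₗ[ℝ] ℝ × ℝ :=
    ((EuclideanSpace.proj i : EuclideanSpace ℝ (Fin l) →L[ℝ] ℝ) :
      EuclideanSpace ℝ (Fin l) →ₗ[ℝ] ℝ).prod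
      (EuclideanSpace.proj j : EuclideanSpace ℝ (Fin l) →L[ℝ] ℝ) with hT
  have hTapp : ∀ z, T z = (z i, z j) := fun z => rfl
  have hrange : LinearMap.range T = ⊤ := by
    refine LinearMap.range_eq_top.2 fun ab => ?_
    refine ⟨EuclideanSpace.single i ab.1 + EuclideanSpace.single j ab.2, ?_⟩
    rw [hTapp]
    simp [hij, hij.symm]
  have hfin : Module.finrank ℝ (LinearMap.ker T) + 2 = l := by
    have := LinearMap.finrank_range_add_finrank_ker T
    rw [hrange, finrank_top, Module.finrank_prod, Module.finrank_self,
      finrank_euclideanSpace_fin] at this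
    omega
  have hker : (μH[(l : ℝ) - 1] : Measure (LinearMap.ker T)) = 0 := by
    refine Real.hausdorffMeasure_of_finrank_lt ?_
    have : (Module.finrank ℝ (LinearMap.ker T) : ℝ) + 2 = l := by exact_mod_cast hfin
    linarith
  have hiso : Isometry fun w : LinearMap.ker T => z₀ + (w : EuclideanSpace ℝ (Fin l)) :=
    (isometry_add_left z₀).comp isometry_subtype_coe
  refine measure_mono_null (t := (fun w : LinearMap.ker T => z₀ + (w : EuclideanSpace ℝ (Fin l))) ''
    Set.univ) ?_ ?_
  · intro z hz
    refine ⟨⟨z - z₀, ?_⟩, Set.mem_univ _, by simp⟩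
    rw [LinearMap.mem_ker, map_sub, hTapp, hTapp, hz.1, hz.2, hz₀.1, hz₀.2, sub_self]
  · rw [hiso.hausdorffMeasure_image (Or.inl (by linarith)), hker]
    simp

/-- The cone spanned by two vectors with a nonvanishing coordinate minor meets, after translation,
a rational coordinate plane of codimension two. -/
theorem exists_rat_combination {i j : Fin l} {y p q : EuclideanSpace ℝ (Fin l)}
    (hD : p i * q j - p j * q i ≠ 0) :
    ∃ (r t : ℚ) (a b : ℝ), 0 ≤ a ∧ 0 ≤ b ∧
      (y + (a • p + b • q)) i = r ∧ (y + (a • p + b • q)) j = t := by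
  set D := p i * q j - p j * q i with hDdef
  -- Cramer's rule: `A v` and `B v` are the coefficients of `p` and `q` for which coordinates `i`,
  -- `j` of the translate equal `v`.
  set A : ℝ × ℝ → ℝ := fun v => ((v.1 - y i) * q j - (v.2 - y j) * q i) / D with hA
  set B : ℝ × ℝ → ℝ := fun v => ((v.2 - y j) * p i - (v.1 - y i) * p j) / D with hB
  have hAc : Continuous A := by fun_prop
  have hBc : Continuous B := by fun_prop
  have hopen : IsOpen {v | 0 < A v ∧ 0 < B v} :=
    (isOpen_lt continuous_const hAc).inter (isOpen_lt continuous_const hBc)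
  have hne : {v | 0 < A v ∧ 0 < B v}.Nonempty := by
    refine ⟨(y i + (p i + q i), y j + (p j + q j)), ?_, ?_⟩
    · have : A (y i + (p i + q i), y j + (p j + q j)) = 1 := by
        simp only [hA]
        rw [div_eq_one_iff_eq hD]
        ring
      rw [this]
      exact one_pos
    · have : B (y i + (p i + q i), y j + (p j + q j)) = 1 := by
        simp only [hB]
        rw [div_eq_one_iff_eq hD]
        ring
      rw [this]
      exact one_pos
  have hdense : DenseRange (Prod.map ((↑) : ℚ → ℝ) ((↑) : ℚ → ℝ)) :=
    Rat.denseRange_cast.prodMap Rat.denseRange_cast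
  obtain ⟨⟨r, t⟩, hrt⟩ := hdense.exists_mem_open hopen hne
  refine ⟨r, t, A (r, t), B (r, t), hrt.1.le, hrt.2.le, ?_, ?_⟩
  · simp only [hA, hB, PiLp.add_apply, PiLp.smul_apply, smul_eq_mul]
    field_simp
    rw [hDdef]
    ring
  · simp only [hA, hB, PiLp.add_apply, PiLp.smul_apply, smul_eq_mul]
    field_simp
    rw [hDdef]
    ring

/-- Two unit vectors all of whose coordinate minors vanish are equal or opposite. -/
theorem eq_or_eq_neg_of_minors_eq_zero {p q : EuclideanSpace ℝ (Fin l)} (hp : ‖p‖ = 1)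
    (hq : ‖q‖ = 1) (h : ∀ i j, p i * q j - p j * q i = 0) : q = p ∨ q = -p := by
  have hp0 : p ≠ 0 := by
    rintro rfl
    simp at hp
  obtain ⟨i, hi⟩ : ∃ i, p i ≠ 0 := by
    by_contra! hcon
    exact hp0 (PiLp.ext hcon)
  have hqp : q = (q i / p i) • p := by
    refine PiLp.ext fun j => ?_
    rw [PiLp.smul_apply, smul_eq_mul]
    field_simp
    linarith [h i j]
  have habs : |q i / p i| = 1 := by
    rw [hqp, norm_smul, hp, mul_one, Real.norm_eq_abs] at hq
    exact hq
  rcases eq_or_eq_neg_of_abs_eq habs with h1 | h1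
  · left
    rw [hqp, h1, one_smul]
  · right
    rw [hqp, h1, neg_one_smul]

/-- Almost all points of a set with nonempty interior have at most one unit normal. -/
theorem hausdorffMeasure_setOf_two_normals {K : Set (EuclideanSpace ℝ (Fin l))}
    (hK : (interior K).Nonempty) :
    (μH[(l : ℝ) - 1] : Measure (EuclideanSpace ℝ (Fin l)))
      {y | y ∈ K ∧ ∃ p ∈ normalCone K y, ∃ q ∈ normalCone K y, ‖p‖ = 1 ∧ ‖q‖ = 1 ∧ p ≠ q} = 0 := by
  have hnull : (μH[(l : ℝ) - 1] : Measure (EuclideanSpace ℝ (Fin l)))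
      (⋃ (i : Fin l) (j : Fin l) (_ : i ≠ j) (r : ℚ) (t : ℚ),
        {y | y ∈ K ∧ ∃ z ∈ {z : EuclideanSpace ℝ (Fin l) | z i = r ∧ z j = t},
          z - y ∈ normalCone K y}) = 0 := by
    simp only [measure_iUnion_null_iff]
    intro i j hij r t
    -- Distinct indices force `2 ≤ l`, so the exponent `l - 1` is nonnegative; for smaller `l` the
    -- union is empty.
    have hl : (2 : ℝ) ≤ l := by exact_mod_cast two_le_of_ne hij
    exact hausdorffMeasure_normal_foot_eq_zero K (by linarith)
      (hausdorffMeasure_coordinatePlane hij _ _)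
  refine measure_mono_null ?_ hnull
  rintro y ⟨hy, p, hp, q, hq, hp1, hq1, hpq⟩
  obtain ⟨i, j, hD⟩ : ∃ i j, p i * q j - p j * q i ≠ 0 := by
    by_contra! hcon
    rcases eq_or_eq_neg_of_minors_eq_zero hp1 hq1 hcon with h | h
    · exact hpq h.symm
    · refine neg_notMem_normalCone hK ?_ hp (h ▸ hq)
      rintro rfl
      simp at hp1
  have hij : i ≠ j := by
    rintro rfl
    exact hD (sub_self _)
  obtain ⟨r, t, a, b, ha, hb, h1, h2⟩ := exists_rat_combination (y := y) hD
  simp only [Set.mem_iUnion]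
  refine ⟨i, j, hij, r, t, hy, _, ⟨h1, h2⟩, ?_⟩
  rw [add_sub_cancel_left]
  exact smul_add_smul_mem_normalCone hp hq ha hb

theorem ae_frontier_existsUnique_normal {K : Set (EuclideanSpace ℝ (Fin l))}
    (hclosed : IsClosed K) (hc : Convex ℝ K) (hK : (interior K).Nonempty) :
    ∀ᵐ y ∂((μH[(l : ℝ) - 1] : Measure (EuclideanSpace ℝ (Fin l))).restrict (frontier K)),
      y ∈ K ∧ ∃ p, normalCone K y ∩ Metric.sphere 0 1 = {p} := by
  rw [ae_restrict_iff' isClosed_frontier.measurableSet]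
  filter_upwards [measure_eq_zero_iff_ae_notMem.1 (hausdorffMeasure_setOf_two_normals hK)]
    with y hy hyf
  have hyK : y ∈ K := hclosed.frontier_subset hyf
  obtain ⟨p, hp, hp1⟩ := exists_unit_mem_normalCone hc hK hyf
  refine ⟨hyK, p, Set.eq_singleton_iff_unique_mem.2 ⟨⟨hp, by simpa using hp1⟩, ?_⟩⟩
  rintro q ⟨hq, hq1⟩
  by_contra hqp
  exact hy ⟨hyK, q, hq, p, hp, by simpa using hq1, hp1, hqp⟩

end Euclidean

/-! ### Half-spaces, convex processes and the conclusion. -/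

theorem isClosedHalfSpace_setOf_inner_le {X Y : Type*} [NormedAddCommGroup X]
    [InnerProductSpace ℝ X] [NormedAddCommGroup Y] [InnerProductSpace ℝ Y] {p : Y} (hp : p ≠ 0)
    (φ : X →L[ℝ] ℝ) : IsClosedHalfSpace {z : X × Y | ⟪p, z.2⟫ ≤ φ z.1} := by
  refine ⟨(innerSL ℝ p).comp (ContinuousLinearMap.snd ℝ X Y) -
    φ.comp (ContinuousLinearMap.fst ℝ X Y), fun h => ?_, ?_⟩
  · have := DFunLike.congr_fun h ((0 : X), p)
    simp [hp] at this
  · ext z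
    simp

theorem IsClosedHalfSpace.isConvexProcess {X Y : Type*} [NormedAddCommGroup X]
    [InnerProductSpace ℝ X] [NormedAddCommGroup Y] [InnerProductSpace ℝ Y] {T : X → Set Y}
    (h : IsClosedHalfSpace (graph T)) : IsConvexProcess T := by
  obtain ⟨φ, -, hφ⟩ := h
  refine ⟨?_, ?_, ?_, ?_⟩
  · rw [hφ]
    exact isClosed_le φ.continuous continuous_const
  · rw [hφ]
    exact convex_halfSpace_le φ.toLinearMap.isLinear 0
  · rw [hφ]
    simp
  · rw [hφ]
    intro c hc z hz
    rw [Set.mem_ofPred_eq, map_smul, smul_eq_mul]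
    exact mul_nonpos_of_nonneg_of_nonpos hc.le hz

end SetValuedMap

theorem theorem5 (d l : ℕ)
    (F : EuclideanSpace ℝ (Fin d) → Set (EuclideanSpace ℝ (Fin l)))
    (hcompact : ∀ x, IsCompact (F x))
    (hconvex : ∀ x, StrictConvex ℝ (F x))
    (hinterior : ∀ x, (interior (F x)).Nonempty)
    (hF : SetValuedMap.IsLocallyIsotropicallyLipschitz F) :
    ∀ᵐ x : EuclideanSpace ℝ (Fin d),
      ∀ᵐ y ∂((μH[(l : ℝ) - 1] : Measure (EuclideanSpace ℝ (Fin l))).restrict (frontier (F x))),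
        SetValuedMap.IsDifferentiableAt F x y ∧
        SetValuedMap.IsClosedHalfSpace
          (SetValuedMap.graph (SetValuedMap.graphicalDeriv F x y)) ∧
        ∃ p : EuclideanSpace ℝ (Fin l),
          SetValuedMap.normalCone (F x) y ∩ Metric.sphere 0 1 = {p} ∧
          DifferentiableAt ℝ (fun x' => SetValuedMap.supportFun (F x') p) x ∧
          SetValuedMap.graph (SetValuedMap.graphicalDeriv F x y) =
            {z | ⟪p, z.2⟫ ≤ fderiv ℝ (fun x' => SetValuedMap.supportFun (F x') p) x z.1} := by
  have hne : ∀ x, (F x).Nonempty := fun x => (hinterior x).mono interior_subset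
  have hconv : ∀ x, Convex ℝ (F x) := fun x => (hconvex x).convex
  filter_upwards [SetValuedMap.ae_forall_differentiableAt_supportFun volume hcompact hne hF]
    with x hx
  filter_upwards [SetValuedMap.ae_frontier_existsUnique_normal (hcompact x).isClosed (hconv x)
    (hinterior x)] with y hy
  obtain ⟨hyF, p, hp⟩ := hy
  have hgraph : SetValuedMap.graph (SetValuedMap.graphicalDeriv F x y) =
      {z | ⟪p, z.2⟫ ≤ fderiv ℝ (fun x' => SetValuedMap.supportFun (F x') p) x z.1} :=
    SetValuedMap.tangentCone_graph_eq hcompact hconv hne hF hyF hp (hx p).hasFDerivAt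
  have hp0 : p ≠ 0 := by
    have hmem : p ∈ SetValuedMap.normalCone (F x) y ∩ Metric.sphere 0 1 :=
      hp ▸ Set.mem_singleton p
    exact ne_zero_of_mem_unit_sphere ⟨p, hmem.2⟩
  have hhalf : SetValuedMap.IsClosedHalfSpace
      (SetValuedMap.graph (SetValuedMap.graphicalDeriv F x y)) := by
    rw [hgraph]
    exact SetValuedMap.isClosedHalfSpace_setOf_inner_le hp0 _
  exact ⟨⟨SetValuedMap.isClosed_graph hcompact hne hF, hyF, hhalf.isConvexProcess⟩, hhalf,
    p, hp, hx p, hgraph⟩
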